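/- Let $G$ be a finite group. Let $G_r\le\operatorname{Sym}(G)$ be the group of all right translations $x\mapsto xg$ ($g\in G$), and let $\operatorname{Hol}(G)=N_{\operatorname{Sym}(G)}(G_r)$. Two permutation groups $K_1,K_2\le\operatorname{Sym}(G)$ are called $2$-equivalent if they have the same orbits in the componentwise action on $G^2$. The $2$-closure $K^{(2)}$ of $K\le\operatorname{Sym}(G)$ is the greatest subgroup of $\operatorname{Sym}(G)$ that is $2$-equivalent to $K$, and $K$ is called $2$-closed if $K^{(2)}=K$. A group $K$ with $G_r\le K\le\operatorname{Sym}(G)$ is called $G$-transjugate if every regular subgroup of $K$ isomorphic to $G$ is conjugate in $K$ to $G_r$. The group $G$ is called an $\mathrm{NCI}^{(2)}$-group if every $2$-closed group $K$ with $G_r\le K\le\operatorname{Hol}(G)$ is $G$-transjugate. **Theorem 1.1.** A finite abelian group is an $\mathrm{NCI}^{(2)}$-group if and only if each of its Sylow subgroups is an $\mathrm{NCI}^{(2)}$-group. -/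

import Mathlib

/-- Two permutation groups on `Ω` are 2-equivalent if, acting componentwise on `Ω × Ω`,
they have the same orbits. -/
def TwoEquivalent {Ω : Type*} (K₁ K₂ : Subgroup (Equiv.Perm Ω)) : Prop :=
  ∀ p : Ω × Ω, MulAction.orbit K₁ p = MulAction.orbit K₂ p

/-- The 2-closure of a permutation group `K`: the permutations that agree with some element
of `K` on each ordered pair of points. By `isGreatest_twoClosure` this is the greatest
permutation group that is 2-equivalent to `K`. -/
def twoClosure {Ω : Type*} (K : Subgroup (Equiv.Perm Ω)) : Subgroup (Equiv.Perm Ω) where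
  carrier := {f | ∀ x y : Ω, ∃ k ∈ K, k x = f x ∧ k y = f y}
  one_mem' := fun _ _ => ⟨1, K.one_mem, rfl, rfl⟩
  mul_mem' := by
    intro f g hf hg x y
    obtain ⟨k, hk, hx, hy⟩ := hg x y
    obtain ⟨l, hl, hx', hy'⟩ := hf (g x) (g y)
    refine ⟨l * k, K.mul_mem hl hk, ?_, ?_⟩
    · rw [Equiv.Perm.mul_apply, hx, hx', Equiv.Perm.mul_apply]
    · rw [Equiv.Perm.mul_apply, hy, hy', Equiv.Perm.mul_apply]
  inv_mem' := by
    intro f hf x y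
    obtain ⟨k, hk, hx, hy⟩ := hf (f⁻¹ x) (f⁻¹ y)
    refine ⟨k⁻¹, K.inv_mem hk, ?_, ?_⟩
    · rw [Equiv.Perm.inv_eq_iff_eq, hx]; simp
    · rw [Equiv.Perm.inv_eq_iff_eq, hy]; simp

theorem isGreatest_twoClosure {Ω : Type*} (K : Subgroup (Equiv.Perm Ω)) :
    IsGreatest {K' | TwoEquivalent K' K} (twoClosure K) := by
  constructor
  · rintro ⟨x, y⟩
    ext q
    constructor
    · rintro ⟨⟨f, hf⟩, rfl⟩
      obtain ⟨k, hk, hx, hy⟩ := hf x y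
      exact ⟨⟨k, hk⟩, Prod.ext hx hy⟩
    · rintro ⟨⟨k, hk⟩, rfl⟩
      exact ⟨⟨k, fun _ _ => ⟨k, hk, rfl, rfl⟩⟩, rfl⟩
  · intro K' hK' f hf x y
    have h : (f x, f y) ∈ MulAction.orbit K' (x, y) := ⟨⟨f, hf⟩, rfl⟩
    rw [hK' (x, y)] at h
    obtain ⟨⟨k, hk⟩, hkk⟩ := h
    exact ⟨k, hk, congrArg Prod.fst hkk, congrArg Prod.snd hkk⟩

/-- A permutation group is 2-closed if it equals its 2-closure. -/
def IsTwoClosed {Ω : Type*} (K : Subgroup (Equiv.Perm Ω)) : Prop :=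
  twoClosure K = K

/-- A permutation group is regular if it is transitive and its point stabilizers are trivial. -/
def IsRegularPermGroup {Ω : Type*} (R : Subgroup (Equiv.Perm Ω)) : Prop :=
  MulAction.IsPretransitive R Ω ∧ ∀ x : Ω, MulAction.stabilizer R x = ⊥

/-- The group `G_r` of all right translations `x ↦ x * g` of `G`. -/
def rightTranslations (G : Type*) [Group G] : Subgroup (Equiv.Perm G) where
  carrier := Set.range (fun g : G => Equiv.mulRight g)
  one_mem' := ⟨1, by ext x; simp⟩
  mul_mem' := by
    rintro _ _ ⟨a, rfl⟩ ⟨b, rfl⟩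
    exact ⟨b * a, by ext x; simp [mul_assoc]⟩
  inv_mem' := by
    rintro _ ⟨a, rfl⟩
    exact ⟨a⁻¹, by ext x; simp⟩

/-- The holomorph of `G`: the normalizer of `G_r` in the symmetric group of `G`. -/
def holomorph (G : Type*) [Group G] : Subgroup (Equiv.Perm G) :=
  Subgroup.normalizer (rightTranslations G : Set (Equiv.Perm G))

/-- A `G`-regular subgroup of `Sym(G)`: a regular subgroup isomorphic to `G`. -/
def IsGRegular {G : Type*} [Group G] (R : Subgroup (Equiv.Perm G)) : Prop :=
  IsRegularPermGroup R ∧ Nonempty (R ≃* G)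

/-- A permutation group `K` on `G` is `G`-transjugate if it contains `G_r` and every
`G`-regular subgroup of `K` is conjugate in `K` to `G_r`. -/
def IsGTransjugate {G : Type*} [Group G] (K : Subgroup (Equiv.Perm G)) : Prop :=
  rightTranslations G ≤ K ∧
    ∀ R : Subgroup (Equiv.Perm G), R ≤ K → IsGRegular R →
      ∃ k ∈ K, R.map (MulAut.conj k).toMonoidHom = rightTranslations G

/-- The `NCI^(2)`-property of a group `G`: every 2-closed permutation group `K` with
`G_r ≤ K ≤ Hol(G)` is `G`-transjugate. -/
def IsNCI2Group (G : Type*) [Group G] : Prop :=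
  ∀ K : Subgroup (Equiv.Perm G),
    rightTranslations G ≤ K → IsTwoClosed K → K ≤ holomorph G → IsGTransjugate K

/-!
A finite abelian group is the direct product of its Sylow subgroups, so the theorem reduces to
`A × B` with `A`, `B` finite abelian of coprime orders, followed by induction over finite
families (`isNCI2Group_pi_iff`). Call a 2-closed group `K` with `G_r ≤ K ≤ Hol(G)` admissible for
`G`.

The property passes from `A × B` to `A` (`IsNCI2Group.fst`): if `K` is admissible for `A`, then
`K × B_r` is admissible for `A × B`, and a conjugation of `R × B_r` to `A_r × B_r` inside
`K × B_r` restricts to a conjugation of `R` to `A_r` inside `K`.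

Conversely (`IsNCI2Group.prod`), let `K ≤ Hol(A × B)` be admissible. Every element of
`Hol(A × B)` is a product of a permutation of `A` and one of `B`, because the orders are coprime.
A regular subgroup `R ≤ K` isomorphic to `A × B` is abelian, so its projections `S` and `T` to the
factors are abelian and transitive, hence regular, and counting gives `R = S × T`
(`exists_prod_eq_of_comm`). By coprimality `S ≃* A` and `T ≃* B`. The group `K` itself need not be
a product, but it contains `S × 1` and `1 × T`. The group of all `f` with `f × 1 ∈ K` is again
2-closed, contains `A_r` and lies in `Hol(A)`, so `S` is conjugate to `A_r` by some `k` with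
`k × 1 ∈ K`; similarly `T` is conjugate to `B_r` by some `l` with `1 × l ∈ K`, and `k × l ∈ K`
conjugates `R` to `(A × B)_r`.
-/

/-! ### Permutation groups of a group: elementwise descriptions -/

theorem mem_rightTranslations {G : Type*} [Group G] {f : Equiv.Perm G} :
    f ∈ rightTranslations G ↔ ∃ g : G, ∀ x, f x = x * g := by
  constructor
  · rintro ⟨g, rfl⟩
    exact ⟨g, fun _ => rfl⟩
  · rintro ⟨g, hg⟩
    exact ⟨g, Equiv.ext fun x => (hg x).symm⟩

theorem isTwoClosed_iff {Ω : Type*} {K : Subgroup (Equiv.Perm Ω)} :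
    IsTwoClosed K ↔
      ∀ f : Equiv.Perm Ω, (∀ x y : Ω, ∃ k ∈ K, k x = f x ∧ k y = f y) → f ∈ K := by
  constructor
  · intro h f hf
    rw [← h]
    exact hf
  · intro h
    exact le_antisymm (fun f hf => h f hf) fun f hf _ _ => ⟨f, hf, rfl, rfl⟩

theorem isTwoClosed_rightTranslations (G : Type*) [Group G] :
    IsTwoClosed (rightTranslations G) := by
  rw [isTwoClosed_iff]
  intro f hf
  refine mem_rightTranslations.2 ⟨f 1, fun x => ?_⟩
  obtain ⟨k, hk, h1, hx⟩ := hf 1 x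
  obtain ⟨g, hg⟩ := mem_rightTranslations.1 hk
  rw [← hx, ← h1, hg, hg, one_mul]

/-- A permutation of a finite group lies in the holomorph iff it conjugates each right
translation to a right translation. Finiteness gives the reverse inclusion in the definition
of the normalizer. -/
theorem mem_holomorph {G : Type*} [Group G] [Finite G] {f : Equiv.Perm G} :
    f ∈ holomorph G ↔ ∀ g : G, ∃ g' : G, ∀ x, f (x * g) = f x * g' := by
  constructor
  · intro hf g
    have := (Subgroup.mem_normalizer_iff.1 hf (Equiv.mulRight g)).1 ⟨g, rfl⟩
    obtain ⟨g', hg'⟩ := mem_rightTranslations.1 this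
    refine ⟨g', fun x => ?_⟩
    simpa using hg' (f x)
  · intro h
    have hle : (rightTranslations G).map (MulAut.conj f).toMonoidHom ≤ rightTranslations G := by
      rintro _ ⟨_, ⟨g, rfl⟩, rfl⟩
      obtain ⟨g', hg'⟩ := h g
      refine mem_rightTranslations.2 ⟨g', fun x => ?_⟩
      simpa using hg' (f⁻¹ x)
    have heq : (rightTranslations G).map (MulAut.conj f).toMonoidHom = rightTranslations G :=
      Subgroup.eq_of_le_of_card_ge hle
        (Nat.card_congr ((rightTranslations G).equivMapOfInjective _
          (MulAut.conj f).injective).toEquiv).le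
    exact Subgroup.mem_normalizer_iff_map_conj_eq.2 heq

theorem isRegularPermGroup_iff {Ω : Type*} {R : Subgroup (Equiv.Perm Ω)} :
    IsRegularPermGroup R ↔
      (∀ x y : Ω, ∃ r ∈ R, r x = y) ∧ ∀ r ∈ R, ∀ x : Ω, r x = x → r = 1 := by
  constructor
  · rintro ⟨h1, h2⟩
    refine ⟨fun x y => ?_, fun r hr x hx => ?_⟩
    · obtain ⟨r, hr⟩ := h1.exists_smul_eq x y
      exact ⟨r, r.2, hr⟩
    · have : (⟨r, hr⟩ : R) ∈ MulAction.stabilizer R x := hx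
      rw [h2 x, Subgroup.mem_bot] at this
      exact congrArg Subtype.val this
  · rintro ⟨h1, h2⟩
    refine ⟨⟨fun x y => ?_⟩, fun x => ?_⟩
    · obtain ⟨r, hr, hxy⟩ := h1 x y
      exact ⟨⟨r, hr⟩, hxy⟩
    · rw [Subgroup.eq_bot_iff_forall]
      exact fun r hr => Subtype.ext (h2 r r.2 x hr)

theorem IsRegularPermGroup.card_eq {Ω : Type*} [Nonempty Ω] {R : Subgroup (Equiv.Perm Ω)}
    (hR : IsRegularPermGroup R) : Nat.card R = Nat.card Ω := by
  obtain ⟨h1, h2⟩ := isRegularPermGroup_iff.1 hR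
  obtain ⟨x⟩ := ‹Nonempty Ω›
  refine Nat.card_congr (Equiv.ofBijective (fun r : R => r.1 x) ⟨fun r s hrs => ?_, fun y => ?_⟩)
  · have hrs' : r.1 x = s.1 x := hrs
    have h := h2 (s⁻¹ * r : R).1 (s⁻¹ * r : R).2 x
      (by simp [Equiv.Perm.mul_apply, hrs'])
    exact (inv_mul_eq_one.1 (Subtype.ext h : s⁻¹ * r = 1)).symm
  · obtain ⟨r, hr, hxy⟩ := h1 x y
    exact ⟨⟨r, hr⟩, hxy⟩

theorem isRegularPermGroup_of_comm {Ω : Type*} {R : Subgroup (Equiv.Perm Ω)}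
    (htrans : ∀ x y : Ω, ∃ r ∈ R, r x = y) (hcomm : ∀ r ∈ R, ∀ s ∈ R, r * s = s * r) :
    IsRegularPermGroup R := by
  refine isRegularPermGroup_iff.2 ⟨htrans, fun r hr x hx => Equiv.ext fun y => ?_⟩
  obtain ⟨s, hs, rfl⟩ := htrans x y
  rw [← Equiv.Perm.mul_apply, hcomm r hr s hs, Equiv.Perm.mul_apply, hx, Equiv.Perm.one_apply]

theorem isRegularPermGroup_rightTranslations (G : Type*) [Group G] :
    IsRegularPermGroup (rightTranslations G) := by
  refine isRegularPermGroup_iff.2 ⟨fun x y => ⟨_, ⟨x⁻¹ * y, rfl⟩, by simp⟩, ?_⟩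
  rintro _ ⟨g, rfl⟩ x hx
  ext y
  simp_all

theorem nonempty_rightTranslations_mulEquiv (G : Type*) [Group G] :
    Nonempty (rightTranslations G ≃* G) := by
  -- Composition reverses right translations, hence the inverse.
  let f : G →* rightTranslations G :=
    { toFun := fun g => ⟨Equiv.mulRight g⁻¹, g⁻¹, rfl⟩
      map_one' := by ext; simp
      map_mul' := fun a b => by ext; simp [mul_assoc] }
  refine ⟨(MulEquiv.ofBijective f ⟨fun a b hab => ?_, ?_⟩).symm⟩
  · have := DFunLike.congr_fun (congrArg Subtype.val hab) 1
    simpa [f] using this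
  · rintro ⟨_, g, rfl⟩
    exact ⟨g⁻¹, by simp [f]⟩

/-! ### Invariance under isomorphism -/

theorem IsNCI2Group.of_mulEquiv {G H : Type*} [Group G] [Group H] (e : G ≃* H)
    (hG : IsNCI2Group G) : IsNCI2Group H := by
  let c : Equiv.Perm G ≃* Equiv.Perm H := e.toEquiv.permCongrHom
  have hc : ∀ f x, c f x = e (f (e.symm x)) := fun _ _ => rfl
  have hr : (rightTranslations G).map c.toMonoidHom = rightTranslations H := by
    ext f
    constructor
    · rintro ⟨_, ⟨g, rfl⟩, rfl⟩
      exact mem_rightTranslations.2 ⟨e g, fun x => by simp [hc]⟩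
    · rintro ⟨h, rfl⟩
      exact ⟨_, ⟨e.symm h, rfl⟩, by ext x; simp [hc]⟩
  have hmapcomap (S : Subgroup (Equiv.Perm H)) :
      (S.comap c.toMonoidHom).map c.toMonoidHom = S :=
    Subgroup.map_comap_eq_self_of_surjective c.surjective S
  intro K hK hK2 hKhol
  refine ⟨hK, fun R hRK ⟨hR, ⟨φ⟩⟩ => ?_⟩
  have key := hG (K.comap c.toMonoidHom) (Subgroup.map_le_iff_le_comap.1 (hr ▸ hK)) ?_ ?_
  · obtain ⟨h1, h2⟩ := isRegularPermGroup_iff.1 hR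
    have hreg : IsRegularPermGroup (R.comap c.toMonoidHom) := by
      refine isRegularPermGroup_iff.2 ⟨fun x y => ?_, fun r hr x hx => ?_⟩
      · obtain ⟨r, hr, hxy⟩ := h1 (e x) (e y)
        refine ⟨c.symm r, by simpa using hr, ?_⟩
        apply e.injective
        rw [← hxy]
        have := hc (c.symm r) (e x)
        simpa using this.symm
      · exact c.injective <| (h2 (c r) hr (e x) (by simp [hc, hx])).trans (map_one c).symm
    have ψ : R.comap c.toMonoidHom ≃* R :=
      ((R.comap c.toMonoidHom).equivMapOfInjective c.toMonoidHom c.injective).trans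
        (MulEquiv.subgroupCongr (hmapcomap R))
    obtain ⟨k, hk, hkR⟩ := key.2 (R.comap c.toMonoidHom) (Subgroup.comap_mono hRK)
      ⟨hreg, ⟨ψ.trans (φ.trans e.symm)⟩⟩
    refine ⟨c k, hk, ?_⟩
    rw [← hr, ← hkR, Subgroup.map_map]
    conv_lhs => rw [← hmapcomap R, Subgroup.map_map]
    congr 1
    ext1 f
    simp
  · rw [isTwoClosed_iff] at hK2 ⊢
    intro f hf
    refine hK2 (c f) fun x y => ?_
    obtain ⟨k, hk, hx, hy⟩ := hf (e.symm x) (e.symm y)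
    exact ⟨c k, hk, by simp [hc, hx], by simp [hc, hy]⟩
  · intro f hf
    have hcf := Subgroup.mem_normalizer_iff_map_conj_eq.1 (hKhol hf)
    refine Subgroup.mem_normalizer_iff_map_conj_eq.2
      (Subgroup.map_injective (f := c.toMonoidHom) c.injective ?_)
    rw [hr]
    conv_rhs => rw [← hcf, ← hr, Subgroup.map_map]
    rw [Subgroup.map_map]
    congr 1
    ext1 g
    simp

/-! ### Products of permutation groups -/

/-- The product action: `(f, g)` acts on `Ω × Δ` by `(x, y) ↦ (f x, g y)`. -/
def permProdHom (Ω Δ : Type*) : Equiv.Perm Ω × Equiv.Perm Δ →* Equiv.Perm (Ω × Δ) where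
  toFun u := Equiv.prodCongr u.1 u.2
  map_one' := rfl
  map_mul' _ _ := rfl

theorem permProdHom_injective (Ω Δ : Type*) [Nonempty Ω] [Nonempty Δ] :
    Function.Injective (permProdHom Ω Δ) := by
  obtain ⟨x⟩ := ‹Nonempty Ω›
  obtain ⟨y⟩ := ‹Nonempty Δ›
  intro u v huv
  refine Prod.ext (Equiv.ext fun a => ?_) (Equiv.ext fun b => ?_)
  · exact congrArg Prod.fst (DFunLike.congr_fun huv (a, y))
  · exact congrArg Prod.snd (DFunLike.congr_fun huv (x, b))

/-- A permutation of a finite product each of whose coordinates depends only on the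
corresponding coordinate of the argument is a product of permutations. -/
theorem exists_permProdHom_eq {Ω Δ : Type*} [Finite Ω] [Finite Δ] [Nonempty Ω] [Nonempty Δ]
    (f : Equiv.Perm (Ω × Δ)) (h1 : ∀ x y y', (f (x, y)).1 = (f (x, y')).1)
    (h2 : ∀ x x' y, (f (x, y)).2 = (f (x', y)).2) : ∃ u, permProdHom Ω Δ u = f := by
  obtain ⟨x₀⟩ := ‹Nonempty Ω›
  obtain ⟨y₀⟩ := ‹Nonempty Δ›
  have i1 : Function.Injective fun x => (f (x, y₀)).1 := fun x x' h =>
    congrArg Prod.fst (f.injective (Prod.ext h (h2 x x' y₀)))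
  have i2 : Function.Injective fun y => (f (x₀, y)).2 := fun y y' h =>
    congrArg Prod.snd (f.injective (Prod.ext (h1 x₀ y y') h))
  refine ⟨(Equiv.ofBijective _ (Finite.injective_iff_bijective.1 i1),
    Equiv.ofBijective _ (Finite.injective_iff_bijective.1 i2)), Equiv.ext fun p => ?_⟩
  exact Prod.ext (h1 _ _ _) (h2 _ _ _)

theorem rightTranslations_prod (A B : Type*) [Group A] [Group B] :
    ((rightTranslations A).prod (rightTranslations B)).map (permProdHom A B) =
      rightTranslations (A × B) := by
  ext f
  constructor
  · rintro ⟨⟨_, _⟩, ⟨⟨a, rfl⟩, ⟨b, rfl⟩⟩, rfl⟩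
    exact ⟨(a, b), rfl⟩
  · rintro ⟨⟨a, b⟩, rfl⟩
    exact ⟨(Equiv.mulRight a, Equiv.mulRight b), ⟨⟨a, rfl⟩, ⟨b, rfl⟩⟩, rfl⟩

theorem map_conj_permProdHom {Ω Δ : Type*} (R : Subgroup (Equiv.Perm Ω))
    (S : Subgroup (Equiv.Perm Δ)) (u : Equiv.Perm Ω × Equiv.Perm Δ) :
    ((R.prod S).map (permProdHom Ω Δ)).map (MulAut.conj (permProdHom Ω Δ u)).toMonoidHom =
      ((R.map (MulAut.conj u.1).toMonoidHom).prod
        (S.map (MulAut.conj u.2).toMonoidHom)).map (permProdHom Ω Δ) := by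
  ext f
  constructor
  · rintro ⟨_, ⟨⟨r, s⟩, ⟨hr, hs⟩, rfl⟩, rfl⟩
    exact ⟨(u.1 * r * u.1⁻¹, u.2 * s * u.2⁻¹), ⟨⟨r, hr, rfl⟩, ⟨s, hs, rfl⟩⟩, rfl⟩
  · rintro ⟨⟨_, _⟩, ⟨⟨r, hr, rfl⟩, ⟨s, hs, rfl⟩⟩, rfl⟩
    exact ⟨_, ⟨(r, s), ⟨hr, hs⟩, rfl⟩, rfl⟩

theorem IsRegularPermGroup.prod {Ω Δ : Type*} {R : Subgroup (Equiv.Perm Ω)}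
    {S : Subgroup (Equiv.Perm Δ)} (hR : IsRegularPermGroup R) (hS : IsRegularPermGroup S) :
    IsRegularPermGroup ((R.prod S).map (permProdHom Ω Δ)) := by
  rw [isRegularPermGroup_iff] at *
  constructor
  · intro p q
    obtain ⟨r, hr, hr'⟩ := hR.1 p.1 q.1
    obtain ⟨s, hs, hs'⟩ := hS.1 p.2 q.2
    exact ⟨_, ⟨(r, s), ⟨hr, hs⟩, rfl⟩, Prod.ext hr' hs'⟩
  · rintro _ ⟨⟨r, s⟩, ⟨hr, hs⟩, rfl⟩ p hp
    have h1 : r = 1 := hR.2 r hr p.1 (congrArg Prod.fst hp)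
    have h2 : s = 1 := hS.2 s hs p.2 (congrArg Prod.snd hp)
    rw [h1, h2]
    exact map_one _

theorem IsTwoClosed.prod {Ω Δ : Type*} [Finite Ω] [Finite Δ] [Nonempty Ω] [Nonempty Δ]
    {K : Subgroup (Equiv.Perm Ω)} {L : Subgroup (Equiv.Perm Δ)} (hK : IsTwoClosed K)
    (hL : IsTwoClosed L) : IsTwoClosed ((K.prod L).map (permProdHom Ω Δ)) := by
  rw [isTwoClosed_iff] at *
  intro f hf
  obtain ⟨u, rfl⟩ := exists_permProdHom_eq f
    (fun x y y' => by
      obtain ⟨_, ⟨v, -, rfl⟩, h, h'⟩ := hf (x, y) (x, y')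
      rw [← h, ← h']; rfl)
    (fun x x' y => by
      obtain ⟨_, ⟨v, -, rfl⟩, h, h'⟩ := hf (x, y) (x', y)
      rw [← h, ← h']; rfl)
  refine ⟨u, ⟨hK _ fun x x' => ?_, hL _ fun y y' => ?_⟩, rfl⟩
  · obtain ⟨y⟩ := ‹Nonempty Δ›
    obtain ⟨_, ⟨v, hv, rfl⟩, h, h'⟩ := hf (x, y) (x', y)
    exact ⟨v.1, hv.1, congrArg Prod.fst h, congrArg Prod.fst h'⟩
  · obtain ⟨x⟩ := ‹Nonempty Ω›
    obtain ⟨_, ⟨v, hv, rfl⟩, h, h'⟩ := hf (x, y) (x, y')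
    exact ⟨v.2, hv.2, congrArg Prod.snd h, congrArg Prod.snd h'⟩

theorem permProdHom_mem_holomorph {A B : Type*} [Group A] [Group B] [Finite A] [Finite B]
    {u : Equiv.Perm A × Equiv.Perm B} :
    permProdHom A B u ∈ holomorph (A × B) ↔ u.1 ∈ holomorph A ∧ u.2 ∈ holomorph B := by
  simp only [mem_holomorph]
  constructor
  · intro h
    refine ⟨fun a => ?_, fun b => ?_⟩
    · obtain ⟨g, hg⟩ := h (a, 1)
      exact ⟨g.1, fun x => congrArg Prod.fst (hg (x, 1))⟩
    · obtain ⟨g, hg⟩ := h (1, b)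
      exact ⟨g.2, fun x => congrArg Prod.snd (hg (1, x))⟩
  · rintro ⟨h1, h2⟩ g
    obtain ⟨a, ha⟩ := h1 g.1
    obtain ⟨b, hb⟩ := h2 g.2
    exact ⟨(a, b), fun x => Prod.ext (ha x.1) (hb x.2)⟩

/-! ### Direct factors -/

theorem IsNCI2Group.fst {A B : Type*} [Group A] [Group B] [Finite A] [Finite B]
    (h : IsNCI2Group (A × B)) : IsNCI2Group A := by
  intro K hK hK2 hKhol
  refine ⟨hK, fun R hRK ⟨hR, ⟨φ⟩⟩ => ?_⟩
  have key := h ((K.prod (rightTranslations B)).map (permProdHom A B)) ?_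
    (hK2.prod (isTwoClosed_rightTranslations B)) ?_
  · obtain ⟨ψ⟩ := nonempty_rightTranslations_mulEquiv B
    obtain ⟨_, ⟨u, hu, rfl⟩, huR⟩ := key.2
      ((R.prod (rightTranslations B)).map (permProdHom A B))
      (Subgroup.map_mono (Subgroup.prod_mono hRK le_rfl))
      ⟨hR.prod (isRegularPermGroup_rightTranslations B),
        ⟨(Subgroup.equivMapOfInjective _ _ (permProdHom_injective A B)).symm.trans
          ((Subgroup.prodEquiv _ _).trans (φ.prodCongr ψ))⟩⟩
    refine ⟨u.1, hu.1, ?_⟩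
    rw [map_conj_permProdHom, ← rightTranslations_prod] at huR
    have huR' := Subgroup.map_injective (permProdHom_injective A B) huR
    ext f
    have := SetLike.ext_iff.1 huR' (f, 1)
    simpa only [Subgroup.mem_prod, one_mem, and_true] using this
  · rw [← rightTranslations_prod]
    exact Subgroup.map_mono (Subgroup.prod_mono hK le_rfl)
  · rintro _ ⟨u, hu, rfl⟩
    exact permProdHom_mem_holomorph.2 ⟨hKhol hu.1, Subgroup.le_normalizer hu.2⟩

theorem IsNCI2Group.snd {A B : Type*} [Group A] [Group B] [Finite A] [Finite B]
    (h : IsNCI2Group (A × B)) : IsNCI2Group B :=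
  (h.of_mulEquiv MulEquiv.prodComm).fst

/-! ### Products of abelian groups of coprime order -/

theorem eq_one_of_pow_card_eq_one {A B : Type*} [Group B]
    (hco : (Nat.card A).Coprime (Nat.card B)) {b : B} (hb : b ^ Nat.card A = 1) : b = 1 :=
  orderOf_eq_one_iff.1 <| Nat.eq_one_of_dvd_coprimes hco (orderOf_dvd_of_pow_eq_one hb)
    (orderOf_dvd_natCard b)

/-- The right translation by `(a, 1)` is conjugated by an element of the holomorph to a right
translation of the same order, which is therefore by an element of `A × 1`. -/
theorem exists_permProdHom_eq_of_mem_holomorph {A B : Type*} [Group A] [Group B] [Finite A]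
    [Finite B] (hco : (Nat.card A).Coprime (Nat.card B)) {f : Equiv.Perm (A × B)}
    (hf : f ∈ holomorph (A × B)) : ∃ u, permProdHom A B u = f := by
  have hpow : ∀ g g' : A × B, (∀ x, f (x * g) = f x * g') →
      ∀ n : ℕ, ∀ x, f (x * g ^ n) = f x * g' ^ n := by
    intro g g' h n
    induction n with
    | zero => simp
    | succ n ih => intro x; rw [pow_succ, ← mul_assoc, h, ih, pow_succ, mul_assoc]
  have hone : ∀ g g' : A × B, (∀ x, f (x * g) = f x * g') → ∀ n : ℕ, g ^ n = 1 → g' ^ n = 1 := by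
    intro g g' h n hn
    simpa [hn] using hpow g g' h n 1
  apply exists_permProdHom_eq
  · intro x y y'
    obtain ⟨g, hg⟩ := mem_holomorph.1 hf (1, y⁻¹ * y')
    have hg1 : g.1 = 1 := eq_one_of_pow_card_eq_one hco.symm <| congrArg Prod.fst <|
      hone _ g hg (Nat.card B) (Prod.ext (one_pow _) (pow_card_eq_one' ..))
    simpa [hg1] using (congrArg Prod.fst (hg (x, y))).symm
  · intro x x' y
    obtain ⟨g, hg⟩ := mem_holomorph.1 hf (x⁻¹ * x', 1)
    have hg1 : g.2 = 1 := eq_one_of_pow_card_eq_one hco <| congrArg Prod.snd <|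
      hone _ g hg (Nat.card A) (Prod.ext (pow_card_eq_one' ..) (one_pow _))
    simpa [hg1] using (congrArg Prod.snd (hg (x, y))).symm

/-- If `R × S ≃* A × B` with `R`, `A` of equal order coprime to that of `B`, then `R ≃* A`. -/
theorem nonempty_mulEquiv_of_prod {R S A B : Type*} [Group R] [Group S] [Group A] [Group B]
    [Finite A] [Finite R] (hco : (Nat.card A).Coprime (Nat.card B))
    (hcard : Nat.card R = Nat.card A) (φ : R × S ≃* A × B) : Nonempty (R ≃* A) := by
  let ψ : R →* A := (MonoidHom.fst A B).comp (φ.toMonoidHom.comp (MonoidHom.inl R S))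
  have hψ : Function.Injective ψ := by
    rw [injective_iff_map_eq_one]
    intro r hr
    have hpow : φ (r, 1) ^ Nat.card A = 1 := by
      rw [← map_pow, ← hcard, Prod.pow_mk, pow_card_eq_one', one_pow]
      exact map_one φ
    have h2 : (φ (r, 1)).2 = 1 := eq_one_of_pow_card_eq_one hco (congrArg Prod.snd hpow)
    have h : φ (r, 1) = 1 := Prod.ext hr h2
    exact congrArg Prod.fst ((map_eq_one_iff φ φ.injective).1 h)
  exact ⟨MulEquiv.ofBijective ψ ((Nat.bijective_iff_injective_and_card _).2 ⟨hψ, hcard⟩)⟩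

/-- The projections of an abelian transitive group on `Ω × Δ` are abelian and transitive,
hence regular; comparing orders, the group is the whole product of its projections. -/
theorem exists_prod_eq_of_comm {Ω Δ : Type*} [Finite Ω] [Finite Δ] [Nonempty Ω] [Nonempty Δ]
    {R : Subgroup (Equiv.Perm (Ω × Δ))} (hR : IsRegularPermGroup R)
    (hcomm : ∀ r ∈ R, ∀ s ∈ R, r * s = s * r) (hprod : ∀ r ∈ R, ∃ u, permProdHom Ω Δ u = r) :
    ∃ (S : Subgroup (Equiv.Perm Ω)) (T : Subgroup (Equiv.Perm Δ)), IsRegularPermGroup S ∧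
      IsRegularPermGroup T ∧ (S.prod T).map (permProdHom Ω Δ) = R := by
  have htrans := (isRegularPermGroup_iff.1 hR).1
  set P := R.comap (permProdHom Ω Δ) with hP
  have hPR : P.map (permProdHom Ω Δ) = R := by
    rw [hP, Subgroup.map_comap_eq, inf_eq_right]
    exact hprod
  have hPcomm : ∀ u ∈ P, ∀ v ∈ P, u * v = v * u := fun u hu v hv =>
    permProdHom_injective Ω Δ <| by rw [map_mul, map_mul]; exact hcomm _ hu _ hv
  have hS : IsRegularPermGroup (P.map (MonoidHom.fst _ _)) := by
    refine isRegularPermGroup_of_comm (fun x x' => ?_) ?_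
    · obtain ⟨y⟩ := ‹Nonempty Δ›
      obtain ⟨r, hr, hxx⟩ := htrans (x, y) (x', y)
      obtain ⟨u, rfl⟩ := hprod r hr
      exact ⟨_, ⟨u, hr, rfl⟩, congrArg Prod.fst hxx⟩
    · rintro _ ⟨u, hu, rfl⟩ _ ⟨v, hv, rfl⟩
      exact congrArg Prod.fst (hPcomm u hu v hv)
  have hT : IsRegularPermGroup (P.map (MonoidHom.snd _ _)) := by
    refine isRegularPermGroup_of_comm (fun y y' => ?_) ?_
    · obtain ⟨x⟩ := ‹Nonempty Ω›
      obtain ⟨r, hr, hyy⟩ := htrans (x, y) (x, y')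
      obtain ⟨u, rfl⟩ := hprod r hr
      exact ⟨_, ⟨u, hr, rfl⟩, congrArg Prod.snd hyy⟩
    · rintro _ ⟨u, hu, rfl⟩ _ ⟨v, hv, rfl⟩
      exact congrArg Prod.snd (hPcomm u hu v hv)
  refine ⟨_, _, hS, hT, (Subgroup.eq_of_le_of_card_ge ?_ ?_).symm⟩
  · conv_lhs => rw [← hPR]
    exact Subgroup.map_mono fun u hu => ⟨⟨u, hu, rfl⟩, ⟨u, hu, rfl⟩⟩
  · rw [(hS.prod hT).card_eq, hR.card_eq]

/-- The permutations `f` with `f × 1 ∈ K` form a 2-closed group between the translations and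
the holomorph of `A`, so regular subgroups of `K` of the form `S × T` can be conjugated to the translations
inside `K` by treating the first factor alone. -/
theorem isGTransjugate_comap_fst {A B : Type*} [Group A] [Group B] [Finite A] [Finite B]
    (hA : IsNCI2Group A) {K : Subgroup (Equiv.Perm (A × B))}
    (hK : rightTranslations (A × B) ≤ K) (hK2 : IsTwoClosed K) (hKhol : K ≤ holomorph (A × B)) :
    IsGTransjugate (K.comap ((permProdHom A B).comp (MonoidHom.inl _ _))) := by
  refine hA _ ?_ ?_ ?_
  · rintro _ ⟨a, rfl⟩
    exact hK ⟨(a, 1), Equiv.ext fun x => Prod.ext rfl (mul_one x.2)⟩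
  · rw [isTwoClosed_iff] at *
    intro f hf
    refine hK2 _ fun x y => ?_
    obtain ⟨k, hk, hx, hy⟩ := hf x.1 y.1
    exact ⟨_, hk, Prod.ext hx rfl, Prod.ext hy rfl⟩
  · exact fun f hf => (permProdHom_mem_holomorph.1 (hKhol hf)).1

theorem isGTransjugate_comap_snd {A B : Type*} [Group A] [Group B] [Finite A] [Finite B]
    (hB : IsNCI2Group B) {K : Subgroup (Equiv.Perm (A × B))}
    (hK : rightTranslations (A × B) ≤ K) (hK2 : IsTwoClosed K) (hKhol : K ≤ holomorph (A × B)) :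
    IsGTransjugate (K.comap ((permProdHom A B).comp (MonoidHom.inr _ _))) := by
  refine hB _ ?_ ?_ ?_
  · rintro _ ⟨b, rfl⟩
    exact hK ⟨(1, b), Equiv.ext fun x => Prod.ext (mul_one x.1) rfl⟩
  · rw [isTwoClosed_iff] at *
    intro f hf
    refine hK2 _ fun x y => ?_
    obtain ⟨k, hk, hx, hy⟩ := hf x.2 y.2
    exact ⟨_, hk, Prod.ext rfl hx, Prod.ext rfl hy⟩
  · exact fun f hf => (permProdHom_mem_holomorph.1 (hKhol hf)).2

theorem IsNCI2Group.prod {A B : Type*} [CommGroup A] [CommGroup B] [Finite A] [Finite B]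
    (hco : (Nat.card A).Coprime (Nat.card B)) (hA : IsNCI2Group A) (hB : IsNCI2Group B) :
    IsNCI2Group (A × B) := by
  intro K hK hK2 hKhol
  refine ⟨hK, fun R hRK ⟨hR, ⟨φ⟩⟩ => ?_⟩
  have hcomm : ∀ r ∈ R, ∀ s ∈ R, r * s = s * r := fun r hr s hs =>
    congrArg Subtype.val <| show (⟨r, hr⟩ * ⟨s, hs⟩ : R) = ⟨s, hs⟩ * ⟨r, hr⟩ from
      φ.injective <| by rw [map_mul, map_mul, mul_comm]
  obtain ⟨S, T, hS, hT, rfl⟩ := exists_prod_eq_of_comm hR hcomm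
    fun r hr => exists_permProdHom_eq_of_mem_holomorph hco (hKhol (hRK hr))
  have ψ : S × T ≃* A × B := ((Subgroup.prodEquiv S T).symm.trans
    (Subgroup.equivMapOfInjective _ _ (permProdHom_injective A B))).trans φ
  have hSA : Nonempty (S ≃* A) := nonempty_mulEquiv_of_prod hco hS.card_eq ψ
  have hTB : Nonempty (T ≃* B) := nonempty_mulEquiv_of_prod hco.symm hT.card_eq
    (MulEquiv.prodComm.trans (ψ.trans MulEquiv.prodComm))
  obtain ⟨k, hk, hkS⟩ := (isGTransjugate_comap_fst hA hK hK2 hKhol).2 S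
    (fun s hs => hRK ⟨(s, 1), ⟨hs, T.one_mem⟩, rfl⟩) ⟨hS, hSA⟩
  obtain ⟨l, hl, hlT⟩ := (isGTransjugate_comap_snd hB hK hK2 hKhol).2 T
    (fun t ht => hRK ⟨(1, t), ⟨S.one_mem, ht⟩, rfl⟩) ⟨hT, hTB⟩
  refine ⟨permProdHom A B (k, l), ?_, ?_⟩
  · exact K.mul_mem hk hl
  · rw [map_conj_permProdHom, hkS, hlT, rightTranslations_prod]

/-! ### Finite families of coprime order -/

theorem isNCI2Group_of_subsingleton (G : Type*) [Group G] [Subsingleton G] : IsNCI2Group G :=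
  fun _ hK _ _ => ⟨hK, fun _ _ _ => ⟨1, one_mem _, Subsingleton.elim _ _⟩⟩

theorem isNCI2Group_pi_iff {ι : Type*} [Finite ι] :
    ∀ (A : ι → Type*) [∀ i, CommGroup (A i)] [∀ i, Finite (A i)],
      (Pairwise fun i j => (Nat.card (A i)).Coprime (Nat.card (A j))) →
        (IsNCI2Group (∀ i, A i) ↔ ∀ i, IsNCI2Group (A i)) := by
  induction ι using Finite.induction_empty_option with
  | of_equiv e ih =>
    intro A _ _ hco
    rw [← e.forall_congr_right, ← ih (fun i => A (e i)) fun i j hij => hco (e.injective.ne hij)]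
    let ε : (∀ i, A i) ≃* ∀ i, A (e i) :=
      { (Equiv.piCongrLeft A e).symm with map_mul' := fun _ _ => rfl }
    exact ⟨fun h => h.of_mulEquiv ε, fun h => h.of_mulEquiv ε.symm⟩
  | h_empty => exact fun A _ _ _ => ⟨fun _ i => i.elim, fun _ => isNCI2Group_of_subsingleton _⟩
  | h_option ih =>
    intro A _ _ hco
    rw [Option.forall, ← ih (fun i => A (some i)) fun i j hij => hco (by simpa using hij)]
    let ε : (∀ i, A i) ≃* A none × ∀ i, A (some i) :=
      { Equiv.piOptionEquivProd with map_mul' := fun _ _ => rfl }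
    constructor
    · intro h
      have h' := h.of_mulEquiv ε
      exact ⟨h'.fst, h'.snd⟩
    · rintro ⟨h1, h2⟩
      refine (h1.prod ?_ h2).of_mulEquiv ε.symm
      rw [Nat.card_pi]
      exact Nat.Coprime.prod_right fun i _ => hco (by simp)

/-! ### The Sylow decomposition -/

theorem theorem1p1 (G : Type*) [CommGroup G] [Finite G] :
    IsNCI2Group G ↔ ∀ p : ℕ, p.Prime → ∀ P : Sylow p G, IsNCI2Group P := by
  have hsub {p : ℕ} (hp : p.Prime) : Subsingleton (Sylow p G) := by
    have := Fact.mk hp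
    have P : Sylow p G := default
    have := Sylow.unique_of_normal P inferInstance
    infer_instance
  -- The unique Sylow `p`-subgroup as a product over the one-element type of all of them.
  let ε {p : ℕ} (hp : p.Prime) (P : Sylow p G) : (∀ Q : Sylow p G, Q) ≃* P :=
    haveI := hsub hp
    haveI := Unique.mk' (Sylow p G)
    (MulEquiv.piUnique fun Q : Sylow p G => Q).trans
      (MulEquiv.subgroupCongr (congrArg Sylow.toSubgroup (Subsingleton.elim _ P)))
  have hprime (p : (Nat.card G).primeFactors) : p.1.Prime := Nat.prime_of_mem_primeFactors p.2
  let e := Sylow.directProductOfNormal (G := G) fun P => inferInstance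
  have hiff := isNCI2Group_pi_iff
    (fun p : (Nat.card G).primeFactors => ∀ P : Sylow p G, P) fun p q hpq => by
      have := Fact.mk (hprime p)
      have := Fact.mk (hprime q)
      have P : Sylow p G := default
      have Q : Sylow q G := default
      obtain ⟨m, hm⟩ := P.2.exists_card_eq
      obtain ⟨n, hn⟩ := Q.2.exists_card_eq
      change (Nat.card (∀ P : Sylow p G, P)).Coprime (Nat.card (∀ P : Sylow q G, P))
      rw [Nat.card_congr (ε (hprime p) P).toEquiv, Nat.card_congr (ε (hprime q) Q).toEquiv]
      exact hm ▸ hn ▸ Nat.coprime_pow_primes m n (hprime p) (hprime q) (Subtype.coe_ne_coe.2 hpq)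
  constructor
  · intro h p hp P
    by_cases hdvd : p ∣ Nat.card G
    · have hmem : p ∈ (Nat.card G).primeFactors := by simp [hp, hdvd, Nat.card_pos.ne']
      exact (hiff.1 (h.of_mulEquiv e.symm) ⟨p, hmem⟩).of_mulEquiv (ε hp P)
    · have := Fact.mk hp
      obtain ⟨n, hn⟩ := P.2.exists_card_eq
      have hn0 : n = 0 := by
        by_contra hn0
        exact hdvd (((dvd_pow_self p hn0).trans hn.symm.dvd).trans P.card_subgroup_dvd_card)
      have : Subsingleton P := (Nat.card_eq_one_iff_unique.1 (hn.trans (by rw [hn0, pow_zero]))).1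
      exact isNCI2Group_of_subsingleton P
  · intro h
    refine (hiff.2 fun p => ?_).of_mulEquiv e
    have := Fact.mk (hprime p)
    have P : Sylow p G := default
    exact (h p (hprime p) P).of_mulEquiv (ε (hprime p) P).symm
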